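/- Let $n\ge 0$, $u\in S_n$, $I=\{1,\dots,n-1\}$, and let $\beta=(i_1,\dots,i_k)\in I^k$ be a positive braid word such that some reduced word of $u$ is a (not necessarily contiguous) subword of $\beta$. Put $u_k=u$ and, for $j=k,\dots,1$, let $u_{j-1}=u_js_{i_j}$ if $\ell(u_js_{i_j})<\ell(u_j)$ and $u_{j-1}=u_j$ otherwise. The 3D plabic graph $G_{u,\beta}$ has $n$ horizontal strands, numbered $1,\dots,n$ from bottom to top; for $j=1,\dots,k$, from left to right, it has between the $i_j$-th and $(i_j+1)$-st strands a bridge if $u_{j-1}=u_j$, and otherwise a positive crossing, in which the strand going from lower left to upper right passes over the other one. The $n-1$ regions between neighbouring strands at the left border are the boundary regions. Each bridge $d$ has a soap film $C_d$. It starts at $d$, spans the two strands joined by $d$, and extends to the left, staying attached to these strands; past a crossing it stays attached to the strands that bound it (passing over or under the other strands as forced by the crossings), and when it reaches another bridge from the right while covering the region immediately to the right of that bridge, it continues unchanged if it passes over the top strand or under the bottom strand of the bridge, and otherwise it is cut, i.e. it does not cover the region immediately to the left of the bridge. The bridge $d$ is frozen if $C_d$ covers some boundary region, and mutable otherwise.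 Let $m$ and $f$ be the numbers of mutable and of frozen bridges, and number the films $C_1,\dots,C_{m+f}$ such that the mutable ones come first, and from left to right within each type. Near each bridge, draw two half arrows from the region on its left to the region on its right, and one half arrow each from right to above, right to below, above to left, and below to left. For each half arrow from a region $R$ to a region $R'$, and each pair $(x,y)$ such that $C_x$ covers $R$ and $C_y$ covers $R'$, draw a half arrow $x\to y$. Let $N_{x,y}$ be the total number of half arrows $x\to y$. The half arrow matrix is $H_{x,y}=\frac12(N_{x,y}-N_{y,x})$ for $1\le x,y\le m+f$, and its first $m$ columns form the extended exchange matrix $\widetilde B(Q_{u,\beta})$ of the ice quiver $Q_{u,\beta}$. Let $\partial(C_x)\in\{0,1\}^{n-1}$ be the vector whose $l$-th entry is $1$ exactly if $C_x$ covers the $l$-th boundary region, let $M$ be $-\frac12$ times the Cartan matrix of type $A_{n-1}$, let $D_{x,y}=\partial(C_x)^TM\,\partial(C_y)$, and let $\widehat B^{u,\beta}=H+D$. Then the $(m+f)\times(m+f)$ matrix $\widehat B^{u,\beta}$ has integer entries, and $\det\widehat B^{u,\beta}=(-1)^{m+f}$. In particular, $Q_{u,\beta}$ has really full rank: $\widetilde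 B(Q_{u,\beta})$ has integer entries, and its $m+f$ rows generate $\mathbb Z^m$. -/

import Mathlib

namespace Plabic

/-! ### Permutations and words

Letters are elements of `Fin (n - 1)`; the letter `i` stands for the generator with index `i + 1`
in the 1-based numbering, and a (braid) word is a list of letters, read from left to right. -/

/-- The simple transposition of the two neighbouring positions `i` and `i + 1` (counted from 0). -/
def simpleTransposition {n : ℕ} (i : Fin (n - 1)) : Equiv.Perm (Fin n) :=
  Equiv.swap ⟨i, by omega⟩ ⟨i + 1, by omega⟩

/-- The permutation spelled by a word. -/
def wordPerm {n : ℕ} (w : List (Fin (n - 1))) : Equiv.Perm (Fin n) :=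
  (w.map simpleTransposition).prod

/-- The length of a permutation: the least length of a word that spells it. -/
noncomputable def permLength {n : ℕ} (v : Equiv.Perm (Fin n)) : ℕ :=
  sInf {k : ℕ | ∃ w : List (Fin (n - 1)), wordPerm w = v ∧ w.length = k}

/-- `w` is a reduced word of `v`. -/
def IsReducedWord {n : ℕ} (w : List (Fin (n - 1))) (v : Equiv.Perm (Fin n)) : Prop :=
  wordPerm w = v ∧ w.length = permLength v

/-- Some reduced word of `u` is a (not necessarily contiguous) subword of `β`. -/
def IsSubwordOf {n : ℕ} (u : Equiv.Perm (Fin n)) (β : List (Fin (n - 1))) : Prop :=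
  ∃ w : List (Fin (n - 1)), IsReducedWord w u ∧ w.Sublist β

/-- The Demazure quotient: `v s_i` if this is shorter than `v`, and `v` otherwise. -/
noncomputable def demazureQuotient {n : ℕ} (v : Equiv.Perm (Fin n)) (i : Fin (n - 1)) :
    Equiv.Perm (Fin n) :=
  if permLength (v * simpleTransposition i) < permLength v then v * simpleTransposition i else v

/-- The permutation obtained from `u` by taking the Demazure quotients by the letters of the word,
from its last letter to its first. -/
noncomputable def demazureWord {n : ℕ} (u : Equiv.Perm (Fin n)) (β : List (Fin (n - 1))) :
    Equiv.Perm (Fin n) :=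
  β.foldr (fun i v => demazureQuotient v i) u

/-- The sequence `u_0, u_1, …, u_k` for a word with `k` letters: `u_k = u`, and `u_t` is the
Demazure quotient of `u_{t+1}` by the letter at position `t` (positions are counted from 0). -/
noncomputable def permSeq {n : ℕ} (u : Equiv.Perm (Fin n)) (β : List (Fin (n - 1))) (t : ℕ) :
    Equiv.Perm (Fin n) :=
  demazureWord u (β.drop t)

/-! ### The 3D plabic graph

The graph of `(u, β)` has `n` strands, numbered `1, …, n` from bottom to top. From left to right,
the letter `i` at position `j` of `β` contributes a bridge between the strands `i + 1` and `i + 2`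
if `u_j = u_{j+1}`, and a positive crossing of these two strands otherwise. The vertical slice
number `t` lies between the letters at positions `t - 1` and `t`; slice `0` is the left border. -/

/-- The letter at position `j` of `β` is a bridge of the graph. -/
def IsBridge {n : ℕ} (u : Equiv.Perm (Fin n)) (β : List (Fin (n - 1))) (j : Fin β.length) : Prop :=
  permSeq u β (j + 1) = permSeq u β j

open Classical in
/-- The set of the bridges. -/
noncomputable def bridges {n : ℕ} (u : Equiv.Perm (Fin n)) (β : List (Fin (n - 1))) :
    Finset (Fin β.length) :=
  Finset.univ.filter (IsBridge u β)

/-! ### Soap films -/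

/-- The intersection of a soap film with a vertical slice. A slice is cut by the strands
`1, …, n` into regions; region `l`, for `1 ≤ l ≤ n - 1`, lies between the strands `l` and `l + 1`
(the outer regions `0` and `n` are never covered). `covers l` says that the film covers region `l`.
If the film covers both regions at the strand `l`, then it passes over or under this strand, and
`isOver l` says that it passes over; for all other strands the value of `isOver` has no meaning. -/
structure CrossSection where
  covers : ℕ → Bool
  isOver : ℕ → Bool

namespace CrossSection

/-- The film is not present. -/
def empty : CrossSection := ⟨fun _ => false, fun _ => false⟩

/-- The film immediately to the left of the bridge where it starts, for a bridge between the strands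
`i` and `i + 1`: it covers the region between these two strands and nothing else. -/
def start (i : ℕ) : CrossSection := ⟨fun l => decide (l = i), fun _ => false⟩

/-- Propagation from right to left past a bridge between the strands `i` and `i + 1`. If the film
passes over the top strand or under the bottom strand of the bridge, then it does not change.
Otherwise it is cut: it does not cover the region to the left of the bridge. -/
def passBridge (i : ℕ) (s : CrossSection) : CrossSection where
  covers := Function.update s.covers i
    (s.covers i && ((s.covers (i + 1) && s.isOver (i + 1)) || (s.covers (i - 1) && !s.isOver i)))
  isOver := s.isOver

/-- Propagation from right to left past a positive crossing of the strands `i` and `i + 1`. Read from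
right to left, the strand that passes over goes from height `i + 1` down to height `i`, and the
other one goes up. The film stays attached to the strands that bound it. A strand bounds the film if
exactly one of its two sides is covered, so the side conditions at the heights `i` and `i + 1` are
exchanged; this gives the region between the two strands. If that region is covered on the
right of the crossing, then the film passes the two strands as it did before, at their new heights.
If it is not covered there, then a film bounded by one of the two strands extends with this strand
across the other one: it passes under the other strand (now at height `i`) if its bounding strand
is the one that passes under, and over the other strand (now at height `i + 1`) if its bounding
strand is the one that passes over. -/
def passCrossing (i : ℕ) (s : CrossSection) : CrossSection where
  covers := Function.update s.covers i
    (xor (s.covers (i - 1)) (xor (s.covers i) (s.covers (i + 1))))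
  isOver := if s.covers i then s.isOver ∘ Equiv.swap i (i + 1)
    else Function.update (Function.update s.isOver i false) (i + 1) true

end CrossSection

/-- The left end (slice `0`) of the soap film that starts at position `d` of the word. -/
noncomputable def filmLeftEnd {n : ℕ} (u : Equiv.Perm (Fin n)) :
    List (Fin (n - 1)) → ℕ → CrossSection
  | [], _ => CrossSection.empty
  | i :: _, 0 => CrossSection.start (i + 1)
  | i :: β, d + 1 =>
    if demazureWord u β = demazureWord u (i :: β) then
      (filmLeftEnd u β d).passBridge (i + 1)
    else
      (filmLeftEnd u β d).passCrossing (i + 1)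

/-- The cross-section at slice `t` of the soap film that starts at position `d`. The film extends
from its bridge to the left only. -/
noncomputable def film {n : ℕ} (u : Equiv.Perm (Fin n)) (β : List (Fin (n - 1))) (d t : ℕ) :
    CrossSection :=
  if t ≤ d then filmLeftEnd u (β.drop t) (d - t) else CrossSection.empty

/-- The boundary vector of the soap film that starts at position `d`: the entry with index `l` is
`1` if the film covers the boundary region between the strands `l + 1` and `l + 2` on the left
border, and `0` otherwise. -/
noncomputable def boundary {n : ℕ} (u : Equiv.Perm (Fin n)) (β : List (Fin (n - 1))) (d : ℕ) :
    Fin (n - 1) → ℤ :=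
  fun l => if (film u β d 0).covers (l + 1) then 1 else 0

/-! ### The vertices, mutable ones first, and from left to right within each type -/

/-- A bridge is frozen if its soap film is unbounded, that is, covers some boundary region. -/
def IsFrozen {n : ℕ} (u : Equiv.Perm (Fin n)) (β : List (Fin (n - 1))) (d : ℕ) : Prop :=
  ∃ l : Fin (n - 1), (film u β d 0).covers (l + 1) = true

open Classical in
/-- The bridges of the mutable vertices. -/
noncomputable def mutableBridges {n : ℕ} (u : Equiv.Perm (Fin n)) (β : List (Fin (n - 1))) :
    Finset (Fin β.length) :=
  (bridges u β).filter (fun d => ¬ IsFrozen u β d)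

open Classical in
/-- The bridges of the frozen vertices. -/
noncomputable def frozenBridges {n : ℕ} (u : Equiv.Perm (Fin n)) (β : List (Fin (n - 1))) :
    Finset (Fin β.length) :=
  (bridges u β).filter (fun d => IsFrozen u β d)

/-- The number `m` of mutable vertices. -/
noncomputable def numMutable {n : ℕ} (u : Equiv.Perm (Fin n)) (β : List (Fin (n - 1))) : ℕ :=
  (mutableBridges u β).card

/-- The number `f` of frozen vertices. -/
noncomputable def numFrozen {n : ℕ} (u : Equiv.Perm (Fin n)) (β : List (Fin (n - 1))) : ℕ :=
  (frozenBridges u β).card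

/-- The bridge of each vertex: the vertices are numbered such that the `m` mutable ones come first,
and from left to right within each of the two types. -/
noncomputable def vertexBridge {n : ℕ} (u : Equiv.Perm (Fin n)) (β : List (Fin (n - 1))) :
    Fin (numMutable u β + numFrozen u β) → Fin β.length :=
  Fin.append ((mutableBridges u β).orderEmbOfFin rfl) ((frozenBridges u β).orderEmbOfFin rfl)

/-! ### The matrices -/

/-- The number of half arrows from the film `x` to the film `y` near the bridge at position `j`.
Of the four regions at the bridge (left, right, above, below) there are two half arrows from left to
right and one each from right to above, from right to below, from above to left, and from below to
left; a half arrow between two regions counts if `x` covers the first and `y` the second. -/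
noncomputable def halfArrowsAt {n : ℕ} (u : Equiv.Perm (Fin n)) (β : List (Fin (n - 1)))
    (j : Fin β.length) (x y : ℕ) : ℕ :=
  let i : ℕ := (β.get j : ℕ) + 1
  let left (z : ℕ) : ℕ := ((film u β z j).covers i).toNat
  let right (z : ℕ) : ℕ := ((film u β z (j + 1)).covers i).toNat
  let above (z : ℕ) : ℕ := ((film u β z (j + 1)).covers (i + 1)).toNat
  let below (z : ℕ) : ℕ := ((film u β z (j + 1)).covers (i - 1)).toNat
  2 * left x * right y + right x * above y + right x * below y + above x * left y + below x * left y

/-- The total number of half arrows from the film `x` to the film `y`. -/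
noncomputable def halfArrows {n : ℕ} (u : Equiv.Perm (Fin n)) (β : List (Fin (n - 1)))
    (x y : ℕ) : ℕ :=
  ∑ j ∈ bridges u β, halfArrowsAt u β j x y

/-- The half arrow matrix `H`: half of the number of half arrows from `x` to `y`, where half arrows
in opposite directions cancel. -/
noncomputable def halfArrowMatrix {n : ℕ} (u : Equiv.Perm (Fin n)) (β : List (Fin (n - 1))) :
    Matrix (Fin (numMutable u β + numFrozen u β)) (Fin (numMutable u β + numFrozen u β)) ℚ :=
  Matrix.of fun x y =>
    ((halfArrows u β (vertexBridge u β x) (vertexBridge u β y) : ℚ)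
      - (halfArrows u β (vertexBridge u β y) (vertexBridge u β x) : ℚ)) / 2

/-- The extended exchange matrix of the ice quiver `Q`: the rows are indexed by all vertices and the
columns by the mutable vertices, and the entry at `(x, y)` is the number of arrows from `x` to `y`,
with a minus sign for arrows from `y` to `x`. (Two half arrows make an arrow.) -/
noncomputable def exchangeMatrix {n : ℕ} (u : Equiv.Perm (Fin n)) (β : List (Fin (n - 1))) :
    Matrix (Fin (numMutable u β + numFrozen u β)) (Fin (numMutable u β)) ℚ :=
  (halfArrowMatrix u β).submatrix id (Fin.castAdd (numFrozen u β))

/-- The boundary correction form: the bilinear form with the matrix `-1/2` times the Cartan matrix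
of type A with `n - 1` nodes. -/
def boundaryForm {n : ℕ} (a b : Fin (n - 1) → ℤ) : ℚ :=
  (fun l => (a l : ℚ)) ⬝ᵥ
    (((-1 / 2 : ℚ) • (CartanMatrix.A (n - 1)).map (Int.cast : ℤ → ℚ)).mulVec fun l => (b l : ℚ))

/-- The boundary correction matrix `D`. -/
noncomputable def boundaryCorrectionMatrix {n : ℕ} (u : Equiv.Perm (Fin n))
    (β : List (Fin (n - 1))) :
    Matrix (Fin (numMutable u β + numFrozen u β)) (Fin (numMutable u β + numFrozen u β)) ℚ :=
  Matrix.of fun x y =>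
    boundaryForm (boundary u β (vertexBridge u β x)) (boundary u β (vertexBridge u β y))

/-- The square matrix `H + D`. -/
noncomputable def extendedMatrix {n : ℕ} (u : Equiv.Perm (Fin n)) (β : List (Fin (n - 1))) :
    Matrix (Fin (numMutable u β + numFrozen u β)) (Fin (numMutable u β + numFrozen u β)) ℚ :=
  halfArrowMatrix u β + boundaryCorrectionMatrix u β

/-- An extended exchange matrix (columns indexed by the mutable vertices) has really full rank: its
entries are integers, and its rows generate the whole lattice of integer vectors. -/
def HasReallyFullRank {k m : ℕ} (B : Matrix (Fin k) (Fin m) ℚ) : Prop :=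
  ∃ B' : Matrix (Fin k) (Fin m) ℤ, B'.map (Int.cast : ℤ → ℚ) = B ∧
    Submodule.span ℤ (Set.range B'.row) = ⊤

end Plabic

/-!
Let `c x t` be the indicator vector of the regions covered by the film of the bridge `x` in the
slice `t`, and for a letter at position `j` between the strands `i` and `i + 1` put

* `coverageDrop j y = c y (j + 1) i - c y j i`,
* `coverageWeight j x = c x (j + 1) i + c x j i - c x (j + 1) (i + 1) - c x (j + 1) (i - 1)`.

The matrix `H + D` is the product of the integer matrices `coverageWeight` (films × bridges) and
`coverageDrop` (bridges × films). Since the film of `x` exists only to the left of `x`, and begins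
there by covering the single region `i`, both factors are triangular when the bridges are ordered
from left to right, with the diagonal entries `1` and `-1`. This gives integrality and the
determinant (`det_weightMatrix`, `det_dropMatrix`). The films of mutable bridges have boundary
vector `0`, so the exchange matrix consists of columns of a matrix that is invertible over `ℤ`.

The factorization (`halfArrows_add_boundaryForm`) is a telescoping sum. Evaluate the form `D` on the
vectors `c x t` and `c y t` in each slice `t`; it vanishes in the last slice and is `D` in slice `0`.
Passing a letter from right to left subtracts `coverageDrop` times a basis vector from each of the
vectors, so by `boundaryForm_sub_single` the form increases by the symmetrization of
`coverageWeight x * coverageDrop y`. At a bridge, the half arrows form the antisymmetrization of the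
same product (`halfArrowsAt_sub`), and the sum of the two is the product itself.

At a crossing there are no half arrows, and the form has to be invariant. This holds because the
vectors change by a simple reflection, so that `coverageWeight` vanishes
(`Compatible.passCrossing_covers`). Reflection and the rule for films agree unless the film, or a
gap in it, is caught between the two crossing strands. The invariant
`CrossSection.Compatible` rules that out: the strands to the left of a slice form a reduced diagram
of the permutation `u_t`, so they are layered, and two strands cross there only if they form an
inversion. If a film passes under a strand, or starts at it, and passes over a higher strand, or
ends at it, then these two do not form an inversion, and neither do the two strands that bound a
gap. For this, the letters at descents have to be recognized as the crossings
(`permLength_mul_lt_iff`), which is the exchange condition.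
-/

namespace Plabic

/-! ### Length and descents -/

lemma wordPerm_cons {n : ℕ} (i : Fin (n - 1)) (w : List (Fin (n - 1))) :
    wordPerm (i :: w) = simpleTransposition i * wordPerm w := by
  simp [wordPerm]

lemma exists_wordPerm_eq {n : ℕ} (v : Equiv.Perm (Fin n)) :
    ∃ w : List (Fin (n - 1)), wordPerm w = v := by
  cases n with
  | zero => exact ⟨[], Subsingleton.elim _ _⟩
  | succ n =>
    have hv : v ∈ Submonoid.closure
        (Set.range fun i : Fin n ↦ Equiv.swap i.castSucc i.succ) := by
      rw [Equiv.Perm.mclosure_swap_castSucc_succ]; trivial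
    induction hv using Submonoid.closure_induction_left with
    | one => exact ⟨[], rfl⟩
    | mul_left x hx y _ ih =>
      obtain ⟨i, rfl⟩ := hx
      obtain ⟨w, rfl⟩ := ih
      exact ⟨(i : Fin (n + 1 - 1)) :: w, wordPerm_cons (n := n + 1) i w⟩

/-- The position of the lower strand moved by the letter `i`. -/
def lowerPos {n : ℕ} (i : Fin (n - 1)) : Fin n := ⟨i, by omega⟩

/-- The position of the upper strand moved by the letter `i`. -/
def upperPos {n : ℕ} (i : Fin (n - 1)) : Fin n := ⟨i + 1, by omega⟩

lemma simpleTransposition_eq {n : ℕ} (i : Fin (n - 1)) :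
    simpleTransposition i = Equiv.swap (lowerPos i) (upperPos i) := rfl

lemma lowerPos_lt_upperPos {n : ℕ} (i : Fin (n - 1)) : lowerPos i < upperPos i := by
  simp [lowerPos, upperPos, Fin.lt_def]

/-- The exchange condition: a letter can be deleted from a word of a permutation with a descent at
`i`, so that the descent is undone. -/
lemma exists_word_mul_of_descent {n : ℕ} (i : Fin (n - 1)) (w : List (Fin (n - 1)))
    (h : wordPerm w (upperPos i) < wordPerm w (lowerPos i)) :
    ∃ w' : List (Fin (n - 1)), wordPerm w' = wordPerm w * simpleTransposition i ∧
      w'.length + 1 = w.length := by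
  induction w with
  | nil => exact absurd h (by simpa [wordPerm] using (lowerPos_lt_upperPos i).le)
  | cons j w ih =>
    set P := wordPerm w with hP
    rcases lt_or_ge (P (upperPos i)) (P (lowerPos i)) with hd | hd
    · obtain ⟨w', h1, h2⟩ := ih hd
      exact ⟨j :: w', by rw [wordPerm_cons, wordPerm_cons, h1, mul_assoc], by simp [h2]⟩
    · -- the first letter creates the descent, so it exchanges the values of `P` at `i` and `i + 1`
      have hne : P (lowerPos i) ≠ P (upperPos i) :=
        fun e => (lowerPos_lt_upperPos i).ne (P.injective e)
      have hlt := lt_of_le_of_ne hd hne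
      rw [wordPerm_cons, ← hP, Equiv.Perm.mul_apply, Equiv.Perm.mul_apply,
        simpleTransposition_eq] at h
      have key : P (lowerPos i) = lowerPos j ∧ P (upperPos i) = upperPos j := by
        generalize P (lowerPos i) = a at *
        generalize P (upperPos i) = b at *
        simp only [Equiv.swap_apply_def] at h
        simp only [lowerPos, upperPos, Fin.ext_iff, Fin.lt_def] at *
        grind
      refine ⟨w, ?_, rfl⟩
      rw [wordPerm_cons, ← hP, simpleTransposition_eq, simpleTransposition_eq, ← key.1, ← key.2,
        mul_assoc, Equiv.swap_apply_apply]
      ext x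
      simp

lemma permLength_mul_lt_of_descent {n : ℕ} (v : Equiv.Perm (Fin n)) (i : Fin (n - 1))
    (h : v (upperPos i) < v (lowerPos i)) :
    permLength (v * simpleTransposition i) < permLength v := by
  obtain ⟨w₀, hw₀⟩ := exists_wordPerm_eq v
  obtain ⟨w, rfl, hw⟩ : permLength v ∈
      {k : ℕ | ∃ w : List (Fin (n - 1)), wordPerm w = v ∧ w.length = k} :=
    Nat.sInf_mem ⟨_, w₀, hw₀, rfl⟩
  obtain ⟨w', h1, h2⟩ := exists_word_mul_of_descent i w h
  have : permLength (wordPerm w * simpleTransposition i) ≤ w'.length := Nat.sInf_le ⟨w', h1, rfl⟩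
  omega

lemma permLength_mul_lt_iff {n : ℕ} (v : Equiv.Perm (Fin n)) (i : Fin (n - 1)) :
    permLength (v * simpleTransposition i) < permLength v ↔ v (upperPos i) < v (lowerPos i) := by
  refine ⟨fun h => ?_, permLength_mul_lt_of_descent v i⟩
  by_contra! hle
  have hlt : v (lowerPos i) < v (upperPos i) :=
    lt_of_le_of_ne hle fun e => (lowerPos_lt_upperPos i).ne (v.injective e)
  have := permLength_mul_lt_of_descent (v * simpleTransposition i) i
    (by simpa [simpleTransposition_eq] using hlt)
  rw [mul_assoc, simpleTransposition_eq, Equiv.swap_mul_self, mul_one,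
    ← simpleTransposition_eq] at this
  omega

lemma demazureQuotient_eq_self_iff {n : ℕ} (v : Equiv.Perm (Fin n)) (i : Fin (n - 1)) :
    v = demazureQuotient v i ↔ v (lowerPos i) < v (upperPos i) := by
  have hne : v (lowerPos i) ≠ v (upperPos i) :=
    fun e => (lowerPos_lt_upperPos i).ne (v.injective e)
  simp only [demazureQuotient, permLength_mul_lt_iff]
  split_ifs with h
  · refine ⟨fun e => absurd (DFunLike.congr_fun e (lowerPos i)) ?_, fun h' => absurd h' h.asymm⟩
    simpa [simpleTransposition_eq] using hne
  · exact ⟨fun _ => lt_of_le_of_ne (not_lt.1 h) hne, fun _ => rfl⟩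

lemma demazureQuotient_of_descent {n : ℕ} {v : Equiv.Perm (Fin n)} {i : Fin (n - 1)}
    (h : v (upperPos i) < v (lowerPos i)) :
    demazureQuotient v i = v * simpleTransposition i :=
  if_pos (permLength_mul_lt_of_descent v i h)

/-! ### Films do not wrap around strands that cross -/

namespace CrossSection

/-- The strand at height `x`, counted from `0`, bounds the film from below, or the film covers both
of its sides and passes under it. (The regions next to this strand are `x` and `x + 1`, and its
height in the convention of `isOver` is `x + 1`.) -/
def IsLowerSide (s : CrossSection) (x : ℕ) : Prop :=
  s.covers (x + 1) = true ∧ (s.covers x = true → s.isOver (x + 1) = false)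

/-- The strand at height `x`, counted from `0`, bounds the film from above, or the film covers both
of its sides and passes over it. -/
def IsUpperSide (s : CrossSection) (x : ℕ) : Prop :=
  s.covers x = true ∧ (s.covers (x + 1) = true → s.isOver (x + 1) = true)

/-- Compatibility of a cross-section with the labels `w x` of the strands at the heights `x`,
where strands at heights `x < y` with `w x < w y` do not cross to the left of the slice. The last
two fields say that the pairs of strands between which the film, or a gap in it, is caught do not
cross. -/
structure Compatible (n : ℕ) (w : ℕ → ℕ) (s : CrossSection) : Prop where
  covers_zero : s.covers 0 = false
  covers_top : s.covers n = false
  lt_of_isLowerSide_of_isUpperSide :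
    ∀ x y, x < y → s.IsLowerSide x → s.IsUpperSide y → w x < w y
  lt_of_gap : ∀ x y, x < y → s.covers x = true → s.covers (x + 1) = false →
    s.covers y = false → s.covers (y + 1) = true → w x < w y

/-- A discrete intermediate value property: the lower bounding strand between `a` and `b`. -/
lemma exists_rise (c : ℕ → Bool) {a b : ℕ} (hab : a ≤ b) (ha : c a = false) (hb : c b = true) :
    ∃ z, a ≤ z ∧ z < b ∧ c z = false ∧ c (z + 1) = true := by
  induction b, hab using Nat.le_induction with
  | base => simp_all
  | succ b hab ih => grind

/-- A discrete intermediate value property: the upper bounding strand between `a` and `b`. -/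
lemma exists_fall (c : ℕ → Bool) {a b : ℕ} (hab : a ≤ b) (ha : c a = true) (hb : c b = false) :
    ∃ z, a ≤ z ∧ z < b ∧ c z = true ∧ c (z + 1) = false := by
  induction b, hab using Nat.le_induction with
  | base => simp_all
  | succ b hab ih => grind

/-- The chain of inequalities through the bottom of the next part of the film above `x`. -/
lemma Compatible.lt_of_upper_of_isUpperSide {n : ℕ} {w : ℕ → ℕ} {s : CrossSection}
    (hs : s.Compatible n w) {x y : ℕ} (hxy : x < y) (hx : s.covers x = true)
    (hx' : s.covers (x + 1) = false) (hy : s.IsUpperSide y) : w x < w y := by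
  obtain ⟨z, hz, hzy, h, h'⟩ := exists_rise s.covers hxy hx' hy.1
  exact (hs.lt_of_gap x z hz hx hx' h h').trans
    (hs.lt_of_isLowerSide_of_isUpperSide z y hzy ⟨h', by simp [h]⟩ hy)

/-- The chain of inequalities through the top of the part of the film above `x`. -/
lemma Compatible.lt_of_isLowerSide_of_lower {n : ℕ} {w : ℕ → ℕ} {s : CrossSection}
    (hs : s.Compatible n w) {x y : ℕ} (hxy : x < y) (hx : s.IsLowerSide x)
    (hy : s.covers y = false) (hy' : s.covers (y + 1) = true) : w x < w y := by
  obtain ⟨z, hz, hzy, h, h'⟩ := exists_fall s.covers hxy hx.1 hy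
  exact (hs.lt_of_isLowerSide_of_isUpperSide x z hz hx ⟨h, by simp [h']⟩).trans
    (hs.lt_of_gap z y hzy h h' hy hy')

lemma passBridge_covers_of_ne (s : CrossSection) {i l : ℕ} (h : l ≠ i) :
    (s.passBridge i).covers l = s.covers l := Function.update_of_ne h _ _

lemma passCrossing_covers_of_ne (s : CrossSection) {i l : ℕ} (h : l ≠ i) :
    (s.passCrossing i).covers l = s.covers l := Function.update_of_ne h _ _

lemma compatible_start {n : ℕ} {w : ℕ → ℕ} {k : ℕ} (hk : k + 1 < n) (hw : w k < w (k + 1)) :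
    (start (k + 1)).Compatible n w := by
  constructor <;> simp only [start, IsLowerSide, IsUpperSide] <;> grind

/-- A cut at a bridge makes no new strand a lower or upper side; a new gap is bounded by strands of
the bridge, which do not cross to its left. -/
lemma Compatible.passBridge {n : ℕ} {w : ℕ → ℕ} {s : CrossSection} {k : ℕ}
    (hs : s.Compatible n w) (hk : k + 1 < n) (hw : w k < w (k + 1)) :
    (s.passBridge (k + 1)).Compatible n w := by
  constructor
  · rw [passBridge_covers_of_ne _ (by omega), hs.covers_zero]
  · rw [passBridge_covers_of_ne _ (by omega), hs.covers_top]
  · intro x y hxy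
    have := hs.lt_of_isLowerSide_of_isUpperSide x y hxy
    simp only [CrossSection.passBridge, IsLowerSide, IsUpperSide, Nat.add_sub_cancel] at this ⊢
    grind
  · intro x y hxy
    have h1 := hs.lt_of_gap x y hxy
    have h2 := hs.lt_of_gap (k + 1) y
    have h3 := hs.lt_of_gap x k
    have h4 := hs.lt_of_isLowerSide_of_lower (x := k + 1) (y := y)
    have h5 := hs.lt_of_upper_of_isUpperSide (x := x) (y := k)
    simp only [CrossSection.passBridge, IsLowerSide, IsUpperSide, Nat.add_sub_cancel] at *
    clear hs
    grind

/-- Lower and upper sides move with their strands, except that a strand may leave the film, or be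
newly crossed by it. In the second case it lies beyond the strand of the crossing to which the film
is attached, and inherits the inequalities from that strand. -/
lemma Compatible.passCrossing {n : ℕ} {w w' : ℕ → ℕ} {s : CrossSection} {k : ℕ}
    (hs : s.Compatible n w) (hk : k + 1 < n) (hw : w (k + 1) < w k)
    (hw' : ∀ x, w' x = w (Equiv.swap k (k + 1) x)) :
    (s.passCrossing (k + 1)).Compatible n w' := by
  have e1 : w' k = w (k + 1) := by simp [hw']
  have e2 : w' (k + 1) = w k := by simp [hw']
  have e3 : ∀ x, x ≠ k → x ≠ k + 1 → w' x = w x := fun x h h' => by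
    rw [hw', Equiv.swap_apply_of_ne_of_ne h h']
  -- the two strands cross, so the film is not caught between them, and neither is a gap
  have hA := hs.lt_of_isLowerSide_of_isUpperSide k (k + 1) (by omega)
  have hB := hs.lt_of_gap k (k + 1) (by omega)
  constructor
  · rw [passCrossing_covers_of_ne _ (by omega), hs.covers_zero]
  · rw [passCrossing_covers_of_ne _ (by omega), hs.covers_top]
  · intro x y hxy
    by_cases hx : x = k ∨ x = k + 1 <;> by_cases hy : y = k ∨ y = k + 1
    · grind
    · have h1 := hs.lt_of_isLowerSide_of_isUpperSide k y
      have h2 := hs.lt_of_isLowerSide_of_isUpperSide (k + 1) y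
      have h3 := hs.lt_of_upper_of_isUpperSide (x := k) (y := y)
      have h4 := hs.lt_of_upper_of_isUpperSide (x := k + 1) (y := y)
      have h5 := e3 y
      simp only [CrossSection.passCrossing, IsLowerSide, IsUpperSide, Nat.add_sub_cancel] at *
      clear hs hw' e3
      rcases hx with rfl | rfl
      · cases hc : s.covers (x + 1) <;> simp <;> grind
      · cases hc : s.covers (k + 1) <;> simp <;> grind
    · have h1 := hs.lt_of_isLowerSide_of_isUpperSide x k
      have h2 := hs.lt_of_isLowerSide_of_isUpperSide x (k + 1)
      have h3 := hs.lt_of_isLowerSide_of_lower (x := x) (y := k)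
      have h4 := hs.lt_of_isLowerSide_of_lower (x := x) (y := k + 1)
      have h5 := e3 x
      simp only [CrossSection.passCrossing, IsLowerSide, IsUpperSide, Nat.add_sub_cancel] at *
      clear hs hw' e3
      rcases hy with rfl | rfl
      · cases hc : s.covers (y + 1) <;> simp <;> grind
      · cases hc : s.covers (k + 1) <;> simp <;> grind
    · have h1 := hs.lt_of_isLowerSide_of_isUpperSide x y hxy
      rw [e3 x (by tauto) (by tauto), e3 y (by tauto) (by tauto)]
      simp only [CrossSection.passCrossing, IsLowerSide, IsUpperSide, Nat.add_sub_cancel] at *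
      clear hs hw' e3
      cases hc : s.covers (k + 1) <;> simp <;> grind
  · intro x y hxy
    by_cases hx : x = k ∨ x = k + 1 <;> by_cases hy : y = k ∨ y = k + 1
    · grind
    · have h1 := hs.lt_of_gap k y
      have h2 := hs.lt_of_gap (k + 1) y
      rw [e3 y (by tauto) (by tauto), passCrossing_covers_of_ne _ (by omega : y ≠ k + 1),
        passCrossing_covers_of_ne _ (by omega : y + 1 ≠ k + 1)]
      simp only [CrossSection.passCrossing, IsLowerSide, IsUpperSide, Nat.add_sub_cancel] at *
      clear hs hw' e3
      rcases hx with rfl | rfl <;> simp <;> grind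
    · have h1 := hs.lt_of_gap x k
      have h2 := hs.lt_of_gap x (k + 1)
      rw [e3 x (by tauto) (by tauto), passCrossing_covers_of_ne _ (by omega : x ≠ k + 1),
        passCrossing_covers_of_ne _ (by omega : x + 1 ≠ k + 1)]
      simp only [CrossSection.passCrossing, IsLowerSide, IsUpperSide, Nat.add_sub_cancel] at *
      clear hs hw' e3
      rcases hy with rfl | rfl
      · cases g0 : s.covers y <;> cases g1 : s.covers (y + 1) <;>
          cases g2 : s.covers (y + 1 + 1) <;> simp_all
        · exact h2 hxy.le
        · omega
      · simp; grind
    · have h1 := hs.lt_of_gap x y hxy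
      rw [e3 x (by tauto) (by tauto), e3 y (by tauto) (by tauto),
        passCrossing_covers_of_ne _ (by omega), passCrossing_covers_of_ne _ (by omega),
        passCrossing_covers_of_ne _ (by omega), passCrossing_covers_of_ne _ (by omega)]
      exact h1

/-- Past a crossing the covered regions change by a simple reflection. Compatibility excludes the
patterns `0, 1, 0` and `1, 0, 1` of covered regions at the crossing, for which the exclusive or in
`passCrossing` differs from the linear formula. -/
lemma Compatible.passCrossing_covers {n : ℕ} {w : ℕ → ℕ} {s : CrossSection} {k : ℕ}
    (hs : s.Compatible n w) (hw : w (k + 1) < w k) :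
    (((s.passCrossing (k + 1)).covers (k + 1)).toNat : ℤ) =
      (s.covers (k + 2)).toNat + (s.covers k).toNat - (s.covers (k + 1)).toNat := by
  have hA := hs.lt_of_isLowerSide_of_isUpperSide k (k + 1) (by omega)
  have hB := hs.lt_of_gap k (k + 1) (by omega)
  simp only [CrossSection.passCrossing, IsLowerSide, IsUpperSide, Nat.add_sub_cancel] at *
  cases h0 : s.covers k <;> cases h1 : s.covers (k + 1) <;> cases h2 : s.covers (k + 2) <;>
    simp_all <;> grind

end CrossSection

/-! ### The boundary form -/

open Matrix

/-- The pairing with a simple root. The conditions on `c 0` and `c n` make the formula hold at the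
two ends of the Dynkin diagram as well. -/
lemma cartanMatrix_A_mulVec {n : ℕ} (c : ℕ → ℤ) (h0 : c 0 = 0) (hn : c n = 0) (i : Fin (n - 1)) :
    (CartanMatrix.A (n - 1) *ᵥ fun l => c (l + 1)) i = 2 * c (i + 1) - c (i + 2) - c i := by
  have hterm : ∀ l : ℕ, (if (i : ℕ) = l then (2 : ℤ) else
      if (i : ℕ) + 1 = l ∨ l + 1 = i then -1 else 0) * c (l + 1) =
      (if (i : ℕ) = l then 2 * c (l + 1) else 0) - (if (i : ℕ) + 1 = l then c (l + 1) else 0)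
        - (if (i : ℕ) - 1 = l then (if (i : ℕ) = 0 then 0 else c (l + 1)) else 0) := by
    intro l
    grind
  have hsum : (CartanMatrix.A (n - 1) *ᵥ fun l => c (l + 1)) i =
      ∑ l ∈ Finset.range (n - 1), (if (i : ℕ) = l then (2 : ℤ) else
        if (i : ℕ) + 1 = l ∨ l + 1 = i then -1 else 0) * c (l + 1) := by
    rw [← Fin.sum_univ_eq_sum_range (fun l => (if (i : ℕ) = l then (2 : ℤ) else
      if (i : ℕ) + 1 = l ∨ l + 1 = i then -1 else 0) * c (l + 1))]
    simp [CartanMatrix.A, Matrix.mulVec, dotProduct, Fin.ext_iff]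
  rw [hsum, Finset.sum_congr rfl fun l _ => hterm l]
  simp only [Finset.sum_sub_distrib, Finset.sum_ite_eq, Finset.mem_range]
  have := i.isLt
  grind

lemma boundaryForm_eq {n : ℕ} (a b : Fin (n - 1) → ℤ) :
    boundaryForm a b = -((a ⬝ᵥ CartanMatrix.A (n - 1) *ᵥ b : ℤ) : ℚ) / 2 := by
  simp only [boundaryForm, Matrix.smul_mulVec, dotProduct_smul, smul_eq_mul]
  have : ((a ⬝ᵥ CartanMatrix.A (n - 1) *ᵥ b : ℤ) : ℚ) = (fun l => (a l : ℚ)) ⬝ᵥ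
      ((CartanMatrix.A (n - 1)).map (Int.cast : ℤ → ℚ)).mulVec fun l => (b l : ℚ) := by
    simp [dotProduct, Matrix.mulVec]
  rw [this]
  ring

/-- The boundary form after multiples of a basis vector are subtracted from both arguments. -/
lemma boundaryForm_sub_single {n : ℕ} (a b : Fin (n - 1) → ℤ) (i : Fin (n - 1)) (p q : ℤ) :
    boundaryForm (a - Pi.single i p) (b - Pi.single i q) = boundaryForm a b +
      ((p * (CartanMatrix.A (n - 1) *ᵥ b) i + q * (CartanMatrix.A (n - 1) *ᵥ a) i : ℤ) : ℚ) / 2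
        - p * q := by
  have hsymm : a ⬝ᵥ CartanMatrix.A (n - 1) *ᵥ Pi.single i q =
      q * (CartanMatrix.A (n - 1) *ᵥ a) i := by
    rw [dotProduct_mulVec, ← mulVec_transpose, CartanMatrix.A_transpose, dotProduct_single,
      mul_comm]
  have hdiag : CartanMatrix.A (n - 1) i i = 2 := by simp [CartanMatrix.A]
  have : (a - Pi.single i p) ⬝ᵥ CartanMatrix.A (n - 1) *ᵥ (b - Pi.single i q) =
      a ⬝ᵥ CartanMatrix.A (n - 1) *ᵥ b - p * (CartanMatrix.A (n - 1) *ᵥ b) i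
        - q * (CartanMatrix.A (n - 1) *ᵥ a) i + 2 * p * q := by
    rw [mulVec_sub, sub_dotProduct, dotProduct_sub, dotProduct_sub, hsymm, single_dotProduct,
      single_dotProduct, mulVec_single]
    simp [hdiag]
    ring
  rw [boundaryForm_eq, boundaryForm_eq, this]
  push_cast
  ring

/-! ### The films of a word -/

variable {n : ℕ} (u : Equiv.Perm (Fin n)) (β : List (Fin (n - 1)))

lemma permSeq_eq_demazureQuotient (j : Fin β.length) :
    permSeq u β j = demazureQuotient (permSeq u β (j + 1)) (β.get j) := by
  rw [permSeq, permSeq, List.drop_eq_getElem_cons j.isLt]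
  rfl

/-- The labels of the strands in a slice: the strand at height `x`, counted from `0`, is labelled by
the value of `v` there, so that, for `v = u_t`, the strands at `x < y` can cross to the left of the
slice `t` only if `(x, y)` is an inversion of `v`. Above the top strand the value is arbitrary. -/
def strandLabel (v : Equiv.Perm (Fin n)) (x : ℕ) : ℕ :=
  if h : x < n then v ⟨x, h⟩ else x

lemma strandLabel_lowerPos (v : Equiv.Perm (Fin n)) (i : Fin (n - 1)) :
    strandLabel v i = v (lowerPos i) := by
  have := i.isLt
  rw [strandLabel, dif_pos (by omega)]; rfl

lemma strandLabel_upperPos (v : Equiv.Perm (Fin n)) (i : Fin (n - 1)) :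
    strandLabel v (i + 1) = v (upperPos i) := by
  have := i.isLt
  rw [strandLabel, dif_pos (by omega)]; rfl

lemma strandLabel_mul_simpleTransposition (v : Equiv.Perm (Fin n)) (i : Fin (n - 1)) (x : ℕ) :
    strandLabel (v * simpleTransposition i) x = strandLabel v (Equiv.swap (i : ℕ) (i + 1) x) := by
  have := i.isLt
  have hv : ∀ a b : Fin n, a = b → (v a : ℕ) = v b := fun a b h => by rw [h]
  simp only [strandLabel, simpleTransposition, Equiv.Perm.mul_apply, Equiv.swap_apply_def,
    Fin.ext_iff]
  split_ifs <;> omega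

lemma IsBridge.strandLabel_lt {j : Fin β.length} (h : IsBridge u β j) :
    strandLabel (permSeq u β j) (β.get j) < strandLabel (permSeq u β j) (β.get j + 1) := by
  have h' := h
  rw [IsBridge, permSeq_eq_demazureQuotient, demazureQuotient_eq_self_iff] at h'
  rw [strandLabel_lowerPos, strandLabel_upperPos, ← show permSeq u β (j + 1) = permSeq u β j from h]
  exact h'

lemma descent_of_not_isBridge {j : Fin β.length} (h : ¬ IsBridge u β j) :
    permSeq u β (j + 1) (upperPos (β.get j)) < permSeq u β (j + 1) (lowerPos (β.get j)) := by
  rw [IsBridge, permSeq_eq_demazureQuotient, demazureQuotient_eq_self_iff, not_lt] at h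
  exact lt_of_le_of_ne h fun e =>
    (lowerPos_lt_upperPos (β.get j)).ne' ((permSeq u β (j + 1)).injective e)

lemma strandLabel_lt_of_not_isBridge {j : Fin β.length} (h : ¬ IsBridge u β j) :
    strandLabel (permSeq u β (j + 1)) (β.get j + 1) <
      strandLabel (permSeq u β (j + 1)) (β.get j) := by
  rw [strandLabel_lowerPos, strandLabel_upperPos]
  exact descent_of_not_isBridge u β h

lemma film_of_lt {d t : ℕ} (h : d < t) : film u β d t = CrossSection.empty :=
  if_neg (by omega)

lemma film_self (j : Fin β.length) :
    film u β j j = CrossSection.start (β.get j + 1) := by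
  rw [film, if_pos le_rfl, List.drop_eq_getElem_cons j.isLt, Nat.sub_self]
  rfl

lemma film_eq_of_lt {d : ℕ} (j : Fin β.length) (h : j < d) :
    film u β d j =
      open Classical in
      if IsBridge u β j then (film u β d (j + 1)).passBridge (β.get j + 1)
      else (film u β d (j + 1)).passCrossing (β.get j + 1) := by
  obtain ⟨e, rfl⟩ : ∃ e, d = j + 1 + e := ⟨d - (j + 1), by omega⟩
  have h1 : film u β (j + 1 + e) j = filmLeftEnd u (β.drop j) (e + 1) := by
    rw [film, if_pos (by omega), show (j : ℕ) + 1 + e - j = e + 1 by omega]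
  have h2 : film u β (j + 1 + e) (j + 1) = filmLeftEnd u (β.drop (j + 1)) e := by
    rw [film, if_pos (by omega), Nat.add_sub_cancel_left]
  simp only [h1, h2, IsBridge, permSeq]
  rw [List.drop_eq_getElem_cons j.isLt, filmLeftEnd]
  congr 1

/-- The film of a bridge is compatible with the strands in every slice that it meets. -/
lemma film_compatible {d : Fin β.length} (hd : IsBridge u β d) {t : ℕ} (ht : t ≤ d) :
    (film u β d t).Compatible n (strandLabel (permSeq u β t)) := by
  refine Nat.decreasingInduction' (n := (d : ℕ))
    (P := fun t => (film u β d t).Compatible n (strandLabel (permSeq u β t)))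
    (fun k hk _ ih => ?_) ht ?_
  · have hj : k < β.length := hk.trans d.isLt
    have hlt : (β.get ⟨k, hj⟩ : ℕ) + 1 < n := by have := (β.get ⟨k, hj⟩).isLt; omega
    rw [film_eq_of_lt u β ⟨k, hj⟩ hk]
    split_ifs with h
    · have hw := h.strandLabel_lt
      rw [← show permSeq u β (k + 1) = permSeq u β k from h] at hw ⊢
      exact ih.passBridge hlt hw
    · refine ih.passCrossing hlt (strandLabel_lt_of_not_isBridge u β h) fun x => ?_
      rw [permSeq_eq_demazureQuotient u β ⟨k, hj⟩,
        demazureQuotient_of_descent (descent_of_not_isBridge u β h),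
        strandLabel_mul_simpleTransposition]
  · rw [film_self]
    exact CrossSection.compatible_start (by have := (β.get d).isLt; omega) (hd.strandLabel_lt u β)

/-- The indicator of the regions covered by the film from `d` in the slice `t`. -/
noncomputable def coverage (d t l : ℕ) : ℤ := ((film u β d t).covers l).toNat

lemma coverage_of_lt {d t : ℕ} (h : d < t) (l : ℕ) : coverage u β d t l = 0 := by
  simp [coverage, film_of_lt u β h, CrossSection.empty]

lemma coverage_self (j : Fin β.length) (l : ℕ) :
    coverage u β j j l = if l = β.get j + 1 then 1 else 0 := by
  rw [coverage, film_self]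
  by_cases h : l = β.get j + 1
  · simp [CrossSection.start, h]
  · simp only [CrossSection.start, h, decide_false, if_false]
    rfl

/-- A film changes its coverage only in the region at the letter that it passes. For `d = j` this
says that the new film covers only that region. -/
lemma coverage_of_ne {d : Fin β.length} {j : Fin β.length} {l : ℕ} (h : l ≠ β.get j + 1) :
    coverage u β d j l = coverage u β d (j + 1) l := by
  rcases lt_trichotomy (d : ℕ) j with hj | hj | hj
  · rw [coverage_of_lt u β hj, coverage_of_lt u β (by omega)]
  · obtain rfl := Fin.ext hj
    rw [coverage_self, if_neg h, coverage_of_lt u β (by omega)]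
  · simp only [coverage]
    rw [film_eq_of_lt u β j hj]
    split_ifs
    · rw [CrossSection.passBridge_covers_of_ne _ h]
    · rw [CrossSection.passCrossing_covers_of_ne _ h]

lemma coverage_zero {d : Fin β.length} (hd : IsBridge u β d) (t : ℕ) :
    coverage u β d t 0 = 0 := by
  rcases le_or_gt t d with h | h
  · simp [coverage, (film_compatible u β hd h).covers_zero]
  · exact coverage_of_lt u β h 0

lemma coverage_top {d : Fin β.length} (hd : IsBridge u β d) (t : ℕ) :
    coverage u β d t n = 0 := by
  rcases le_or_gt t d with h | h
  · simp [coverage, (film_compatible u β hd h).covers_top]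
  · exact coverage_of_lt u β h n

lemma coverage_of_not_isBridge {d : Fin β.length} (hd : IsBridge u β d) {j : Fin β.length}
    (hj : ¬ IsBridge u β j) :
    coverage u β d j (β.get j + 1) = coverage u β d (j + 1) (β.get j + 2) +
      coverage u β d (j + 1) (β.get j) - coverage u β d (j + 1) (β.get j + 1) := by
  rcases lt_trichotomy (d : ℕ) j with h | h | h
  · simp [coverage_of_lt u β h, coverage_of_lt u β (h.trans (Nat.lt_succ_self _))]
  · obtain rfl := Fin.ext h
    exact absurd hd hj
  · simp only [coverage]
    rw [film_eq_of_lt u β j h, if_neg hj]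
    exact (film_compatible u β hd h).passCrossing_covers (strandLabel_lt_of_not_isBridge u β hj)

/-- The amount by which the coverage of the region at the letter `j` by the film from `d` drops
when the film passes this letter from right to left. -/
noncomputable def coverageDrop (j d : Fin β.length) : ℤ :=
  coverage u β d (j + 1) (β.get j + 1) - coverage u β d j (β.get j + 1)

/-- The coverage of the four regions at the letter `j` by the film from `d`: left and right count
positively, above and below negatively. -/
noncomputable def coverageWeight (j d : Fin β.length) : ℤ :=
  coverage u β d (j + 1) (β.get j + 1) + coverage u β d j (β.get j + 1)
    - coverage u β d (j + 1) (β.get j + 2) - coverage u β d (j + 1) (β.get j)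

lemma coverageDrop_of_lt {j d : Fin β.length} (h : d < j) : coverageDrop u β j d = 0 := by
  rw [Fin.lt_def] at h
  simp [coverageDrop, coverage_of_lt u β h, coverage_of_lt u β (h.trans (Nat.lt_succ_self _))]

lemma coverageDrop_self (j : Fin β.length) : coverageDrop u β j j = -1 := by
  rw [coverageDrop, coverage_self, coverage_of_lt u β (Nat.lt_succ_self _)]
  simp

lemma coverageWeight_of_lt {j d : Fin β.length} (h : d < j) : coverageWeight u β j d = 0 := by
  rw [Fin.lt_def] at h
  simp [coverageWeight, coverage_of_lt u β h, coverage_of_lt u β (h.trans (Nat.lt_succ_self _))]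

lemma coverageWeight_self (j : Fin β.length) : coverageWeight u β j j = 1 := by
  simp [coverageWeight, coverage_self, coverage_of_lt u β (Nat.lt_succ_self _)]

/-! ### The boundary form in the slices -/

/-- The analogue of the boundary vector for the slice `t`. -/
noncomputable def sliceVector (d t : ℕ) : Fin (n - 1) → ℤ := fun l => coverage u β d t (l + 1)

lemma boundary_eq_sliceVector (d : ℕ) : boundary u β d = sliceVector u β d 0 := by
  ext l
  simp only [boundary, sliceVector, coverage]
  cases (film u β d 0).covers (l + 1) <;> rfl

lemma sliceVector_eq_sub_single (j d : Fin β.length) :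
    sliceVector u β d j =
      sliceVector u β d (j + 1) - Pi.single (β.get j) (coverageDrop u β j d) := by
  ext l
  rcases eq_or_ne l (β.get j) with rfl | h
  · simp [sliceVector, coverageDrop]
  · have : (l : ℕ) + 1 ≠ β.get j + 1 := fun e => h (Fin.ext (by omega))
    simp only [sliceVector, Pi.sub_apply, Pi.single_eq_of_ne h, sub_zero]
    exact coverage_of_ne u β this

lemma cartanMatrix_mulVec_sliceVector {d : Fin β.length} (hd : IsBridge u β d)
    (j : Fin β.length) :
    (CartanMatrix.A (n - 1) *ᵥ sliceVector u β d (j + 1)) (β.get j) =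
      coverageWeight u β j d + coverageDrop u β j d := by
  have := cartanMatrix_A_mulVec (coverage u β d (j + 1)) (coverage_zero u β hd _)
    (coverage_top u β hd _) (β.get j)
  rw [coverageWeight, coverageDrop]
  unfold sliceVector
  rw [this]
  ring

/-- The boundary form of two films in the slice `t`. -/
noncomputable def sliceForm (x y t : ℕ) : ℚ :=
  boundaryForm (sliceVector u β x t) (sliceVector u β y t)

lemma sliceForm_eq {x y : Fin β.length} (hx : IsBridge u β x) (hy : IsBridge u β y)
    (j : Fin β.length) :
    sliceForm u β x y j = sliceForm u β x y (j + 1) +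
      ((coverageDrop u β j x * coverageWeight u β j y +
        coverageDrop u β j y * coverageWeight u β j x : ℤ) : ℚ) / 2 := by
  rw [sliceForm, sliceVector_eq_sub_single u β j x, sliceVector_eq_sub_single u β j y,
    boundaryForm_sub_single, cartanMatrix_mulVec_sliceVector u β hx,
    cartanMatrix_mulVec_sliceVector u β hy, sliceForm]
  push_cast
  ring

lemma coverageWeight_of_not_isBridge {d j : Fin β.length} (hd : IsBridge u β d)
    (hj : ¬ IsBridge u β j) : coverageWeight u β j d = 0 := by
  rw [coverageWeight, coverage_of_not_isBridge u β hd hj]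
  ring

/-- At a bridge, the change of the boundary form and the half arrows there add up to a product. -/
lemma halfArrowsAt_sub (j x y : Fin β.length) :
    ((halfArrowsAt u β j x y : ℚ) - halfArrowsAt u β j y x) / 2 =
      ((coverageWeight u β j x * coverageDrop u β j y -
        coverageWeight u β j y * coverageDrop u β j x : ℤ) : ℚ) / 2 := by
  congr 1
  simp only [halfArrowsAt, coverageWeight, coverageDrop, coverage, Nat.add_sub_cancel]
  push_cast
  ring

/-- The entries of the matrix `H + D` as sums of products over the bridges: the boundary form in the
slice `0` is the sum of its changes at the letters, since no film meets the last slice. -/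
lemma halfArrows_add_boundaryForm {x y : Fin β.length} (hx : IsBridge u β x)
    (hy : IsBridge u β y) :
    ((halfArrows u β x y : ℚ) - halfArrows u β y x) / 2 +
        boundaryForm (boundary u β x) (boundary u β y) =
      ((∑ j ∈ bridges u β, coverageWeight u β j x * coverageDrop u β j y : ℤ) : ℚ) := by
  classical
  have hend : sliceForm u β x y β.length = 0 := by
    have : sliceVector u β x β.length = 0 := by
      ext l
      exact coverage_of_lt u β x.isLt _
    simp [sliceForm, boundaryForm, this, dotProduct]
  have htel : sliceForm u β x y 0 = ∑ j : Fin β.length,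
      (sliceForm u β x y j - sliceForm u β x y (j + 1)) := by
    rw [Fin.sum_univ_eq_sum_range (fun t => sliceForm u β x y t - sliceForm u β x y (t + 1)),
      Finset.sum_range_sub', hend, sub_zero]
  have hcross : sliceForm u β x y 0 = ∑ j ∈ bridges u β,
      (sliceForm u β x y j - sliceForm u β x y (j + 1)) := by
    rw [htel]
    refine (Finset.sum_subset (Finset.subset_univ _) fun j _ hj => ?_).symm
    have hj' : ¬ IsBridge u β j := by simpa [bridges] using hj
    rw [sliceForm_eq u β hx hy, coverageWeight_of_not_isBridge u β hx hj',
      coverageWeight_of_not_isBridge u β hy hj']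
    simp
  rw [boundary_eq_sliceVector, boundary_eq_sliceVector]
  change _ + sliceForm u β x y 0 = _
  rw [hcross, halfArrows, halfArrows, Nat.cast_sum, Nat.cast_sum, ← Finset.sum_sub_distrib,
    Finset.sum_div, ← Finset.sum_add_distrib, Int.cast_sum]
  refine Finset.sum_congr rfl fun j _ => ?_
  rw [halfArrowsAt_sub, sliceForm_eq u β hx hy]
  push_cast
  ring

/-! ### The factorization into triangular matrices -/

lemma vertexBridge_castAdd (a : Fin (numMutable u β)) :
    vertexBridge u β (Fin.castAdd (numFrozen u β) a) = (mutableBridges u β).orderEmbOfFin rfl a :=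
  Fin.append_left _ _ a

lemma vertexBridge_natAdd (a : Fin (numFrozen u β)) :
    vertexBridge u β (Fin.natAdd (numMutable u β) a) = (frozenBridges u β).orderEmbOfFin rfl a :=
  Fin.append_right _ _ a

lemma mem_bridges {d : Fin β.length} : d ∈ bridges u β ↔ IsBridge u β d := by
  simp [bridges]

lemma mem_mutableBridges {d : Fin β.length} :
    d ∈ mutableBridges u β ↔ IsBridge u β d ∧ ¬ IsFrozen u β d := by
  simp [mutableBridges, mem_bridges]

lemma mem_frozenBridges {d : Fin β.length} :
    d ∈ frozenBridges u β ↔ IsBridge u β d ∧ IsFrozen u β d := by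
  simp [frozenBridges, mem_bridges]

lemma vertexBridge_castAdd_mem (a : Fin (numMutable u β)) :
    vertexBridge u β (Fin.castAdd (numFrozen u β) a) ∈ mutableBridges u β := by
  rw [vertexBridge_castAdd]
  exact Finset.orderEmbOfFin_mem _ _ _

lemma vertexBridge_natAdd_mem (a : Fin (numFrozen u β)) :
    vertexBridge u β (Fin.natAdd (numMutable u β) a) ∈ frozenBridges u β := by
  rw [vertexBridge_natAdd]
  exact Finset.orderEmbOfFin_mem _ _ _

lemma vertexBridge_injective : Function.Injective (vertexBridge u β) :=
  Fin.append_injective_iff.2 ⟨RelEmbedding.injective _, RelEmbedding.injective _,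
    fun a b e => ((mem_mutableBridges u β).1 (Finset.orderEmbOfFin_mem _ rfl a)).2
      (e ▸ ((mem_frozenBridges u β).1 (Finset.orderEmbOfFin_mem _ rfl b)).2)⟩

lemma isBridge_vertexBridge (z : Fin (numMutable u β + numFrozen u β)) :
    IsBridge u β (vertexBridge u β z) := by
  induction z using Fin.addCases with
  | left a => exact ((mem_mutableBridges u β).1 (vertexBridge_castAdd_mem u β a)).1
  | right a => exact ((mem_frozenBridges u β).1 (vertexBridge_natAdd_mem u β a)).1

lemma image_vertexBridge : Finset.univ.image (vertexBridge u β) = bridges u β := by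
  ext d
  rw [mem_bridges, Finset.mem_image]
  refine ⟨?_, fun hd => ?_⟩
  · rintro ⟨z, -, rfl⟩
    exact isBridge_vertexBridge u β z
  · by_cases hf : IsFrozen u β d
    · have hd' := (mem_frozenBridges u β).2 ⟨hd, hf⟩
      rw [← Finset.image_orderEmbOfFin_univ (frozenBridges u β) rfl, Finset.mem_image] at hd'
      obtain ⟨a, -, rfl⟩ := hd'
      exact ⟨Fin.natAdd _ a, Finset.mem_univ _, vertexBridge_natAdd u β a⟩
    · have hd' := (mem_mutableBridges u β).2 ⟨hd, hf⟩
      rw [← Finset.image_orderEmbOfFin_univ (mutableBridges u β) rfl, Finset.mem_image] at hd'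
      obtain ⟨a, -, rfl⟩ := hd'
      exact ⟨Fin.castAdd _ a, Finset.mem_univ _, vertexBridge_castAdd u β a⟩

/-- The matrix with the entry `coverageWeight` of the film `x` at the bridge `z` at `(x, z)`. -/
noncomputable def weightMatrix :
    Matrix (Fin (numMutable u β + numFrozen u β)) (Fin (numMutable u β + numFrozen u β)) ℤ :=
  Matrix.of fun x z => coverageWeight u β (vertexBridge u β z) (vertexBridge u β x)

/-- The matrix with the entry `coverageDrop` of the film `y` at the bridge `z` at `(z, y)`. -/
noncomputable def dropMatrix :
    Matrix (Fin (numMutable u β + numFrozen u β)) (Fin (numMutable u β + numFrozen u β)) ℤ :=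
  Matrix.of fun z y => coverageDrop u β (vertexBridge u β z) (vertexBridge u β y)

lemma extendedMatrix_eq_map_mul :
    extendedMatrix u β = (weightMatrix u β * dropMatrix u β).map (Int.cast : ℤ → ℚ) := by
  ext x y
  have := halfArrows_add_boundaryForm u β (isBridge_vertexBridge u β x)
    (isBridge_vertexBridge u β y)
  rw [← image_vertexBridge, Finset.sum_image (vertexBridge_injective u β).injOn] at this
  exact this

/-- A matrix that is upper triangular when the indices are ordered along an injection has the
product of its diagonal entries as its determinant. -/
lemma det_of_upperTriangular_along {m : ℕ} {α : Type*} [LinearOrder α] (v : Fin m → α)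
    (hv : Function.Injective v) (M : Matrix (Fin m) (Fin m) ℤ)
    (h : ∀ x y, v y < v x → M x y = 0) : M.det = ∏ x, M x x := by
  have hb : M.BlockTriangular v := fun x y hxy => h x y hxy
  rw [hb.det, Finset.prod_image hv.injOn]
  refine Finset.prod_congr rfl fun x _ => ?_
  have : Unique {a // v a = v x} := ⟨⟨⟨x, rfl⟩⟩, fun a => Subtype.ext (hv a.2)⟩
  rw [Matrix.det_unique]
  have hd : (default : {a // v a = v x}) = ⟨x, rfl⟩ := Subsingleton.elim _ _
  rw [hd]
  rfl

lemma det_weightMatrix : (weightMatrix u β).det = 1 := by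
  rw [← Matrix.det_transpose,
    det_of_upperTriangular_along _ (vertexBridge_injective u β) (weightMatrix u β)ᵀ
      fun x y h => coverageWeight_of_lt u β h]
  exact Finset.prod_eq_one fun x _ => coverageWeight_self u β _

lemma det_dropMatrix : (dropMatrix u β).det = (-1) ^ (numMutable u β + numFrozen u β) := by
  rw [det_of_upperTriangular_along _ (vertexBridge_injective u β) (dropMatrix u β)
    fun x y h => coverageDrop_of_lt u β h]
  simp only [dropMatrix, Matrix.of_apply, coverageDrop_self]
  simp

lemma boundary_eq_zero_of_not_isFrozen {d : ℕ} (h : ¬ IsFrozen u β d) : boundary u β d = 0 := by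
  ext l
  exact if_neg fun hl => h ⟨l, hl⟩

/-- The columns of the mutable vertices are not changed by the boundary correction. -/
lemma exchangeMatrix_eq_submatrix :
    exchangeMatrix u β = (extendedMatrix u β).submatrix id (Fin.castAdd (numFrozen u β)) := by
  ext x y
  simp [exchangeMatrix, extendedMatrix, boundaryCorrectionMatrix, boundaryForm_eq,
    boundary_eq_zero_of_not_isFrozen u β ((mem_mutableBridges u β).1 (vertexBridge_castAdd_mem u β y)).2]

/-- If a square matrix is invertible over the integers, then the rows of the matrix formed by
some of its columns generate the whole lattice. -/
lemma span_row_submatrix_eq_top {m k : ℕ} (M : Matrix (Fin k) (Fin k) ℤ) (hM : IsUnit M.det)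
    (e : Fin m → Fin k) (he : Function.Injective e) :
    Submodule.span ℤ (Set.range (M.submatrix id e).row) = ⊤ := by
  rw [← range_vecMulLinear, LinearMap.range_eq_top]
  intro y
  refine ⟨Function.extend e y 0 ᵥ* M⁻¹, ?_⟩
  ext a
  have : (Function.extend e y 0 ᵥ* M⁻¹) ᵥ* M = Function.extend e y 0 := by
    rw [Matrix.vecMul_vecMul, Matrix.nonsing_inv_mul _ hM, Matrix.vecMul_one]
  calc _ = ((Function.extend e y 0 ᵥ* M⁻¹) ᵥ* M) (e a) := rfl
    _ = y a := by rw [this, he.extend_apply]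

end Plabic

theorem theorem3 (n : ℕ) (u : Equiv.Perm (Fin n)) (β : List (Fin (n - 1)))
    (hu : Plabic.IsSubwordOf u β) :
    (∀ x y, ∃ z : ℤ, Plabic.extendedMatrix u β x y = (z : ℚ)) ∧
    (Plabic.extendedMatrix u β).det = (-1) ^ (Plabic.numMutable u β + Plabic.numFrozen u β) ∧
    Plabic.HasReallyFullRank (Plabic.exchangeMatrix u β) := by
  open Plabic in
  have hdet : (weightMatrix u β * dropMatrix u β).det =
      (-1) ^ (numMutable u β + numFrozen u β) := by
    rw [Matrix.det_mul, det_weightMatrix, det_dropMatrix, one_mul]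
  refine ⟨fun x y => ⟨(weightMatrix u β * dropMatrix u β) x y, ?_⟩, ?_,
    (weightMatrix u β * dropMatrix u β).submatrix id (Fin.castAdd (numFrozen u β)), ?_, ?_⟩
  · rw [extendedMatrix_eq_map_mul, Matrix.map_apply]
  · rw [extendedMatrix_eq_map_mul, ← Int.cast_det, hdet]
    push_cast
    rfl
  · rw [exchangeMatrix_eq_submatrix, extendedMatrix_eq_map_mul, Matrix.submatrix_map]
  · refine span_row_submatrix_eq_top _ ?_ _ (Fin.castAdd_injective _ _)
    rw [hdet]
    exact (isUnit_one.neg).pow _
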